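/- Fix an integer $k\ge 2$. A deterministic finite automaton with output (DFAO) over the input alphabet $\{0,1,\dots,k-1\}$ generates an infinite sequence $\mathbf{x}=a(0)a(1)a(2)\cdots$ as follows: $a(n)$ is the output letter of the last state reached when the automaton reads, most significant digit first, the base-$k$ representation of $n$ without leading zeros (the empty word if $n=0$). The sequences over finite alphabets obtained in this way are the $k$-automatic sequences; letters are coded by natural numbers. In the decision problems below, a $k$-automatic sequence is given by (the finite table describing) a DFAO that generates it. If a finite word $w$ can be written as $w=u^n u'$ with $u$ a nonempty word, $n\ge 1$ an integer and $u'$ a prefix of $u$, then $w$ is a (fractional) power with exponent $|w|/|u|$. The largest such exponent is the exponent of $w$, and the critical exponent of $\mathbf{x}$ is the supremum of the exponents of its finite nonempty factors. A word $w$ is bordered if it begins and ends with the same word $u$ for some $u$ with $0<|u|\le |w|/2$; otherwise it is unbordered. Theorem. The following hold. 1. A $k$-automatic sequence $\mathbf{x}$ has infinite critical exponent if and only if it contains powers of arbitrarily large exponent (that is, for every $C$ it has a factor that is a power with some exponent $\ge C$), and the following question is decidable: given a $k$-automatic sequence $\mathbf{x}$, does $\mathbf{x}$ contain powers of arbitrarily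 large exponent? 2. The following question is decidable: given a $k$-automatic sequence $\mathbf{x}$, does $\mathbf{x}$ contain arbitrarily long unbordered factors (that is, for every $N$, an unbordered factor of length at least $N$)? -/

import Mathlib

open scoped ENNReal

/-- A deterministic finite automaton with output: input alphabet `Σ_k = {0, …, k-1}`, states
`0, …, numStates - 1`, and an output letter (coded by a natural number) attached to each state. -/
structure DFAO (k : ℕ) where
  /-- the number of states (positive, as there is a start state) -/
  numStates : ℕ
  /-- the start state -/
  start : Fin numStates
  /-- the transition function -/
  step : Fin numStates → Fin k → Fin numStates
  /-- the letter contained in each state -/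
  output : Fin numStates → ℕ

/-- The canonical base-`k` representation of `n`: most significant digit first, no leading
zeros, so that `0` is represented by the empty word. -/
def canonicalRep (k : ℕ) (hk : 2 ≤ k) (n : ℕ) : List (Fin k) :=
  ((Nat.digits k n).pmap (fun d (hd : d < k) => (⟨d, hd⟩ : Fin k))
    (fun _ hd => Nat.digits_lt_base hk hd)).reverse

namespace DFAO

variable {k : ℕ}

/-- The state reached from the start state after reading the word `w` from left to right. -/
def run (M : DFAO k) (w : List (Fin k)) : Fin M.numStates :=
  w.foldl M.step M.start

/-- The `k`-automatic sequence generated by `M`: its `n`-th term is the output of the last state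
reached on the base-`k` representation of `n`. -/
def sequence (M : DFAO k) (hk : 2 ≤ k) (n : ℕ) : ℕ :=
  M.output (M.run (canonicalRep k hk n))

/-- The explicit finite description of an automaton: its start state, and the table that lists,
for each state, the row of its transitions and its output. -/
def code (M : DFAO k) : ℕ × List (List ℕ × ℕ) :=
  ((M.start : ℕ),
    List.ofFn fun q => (List.ofFn fun a => ((M.step q a : Fin M.numStates) : ℕ), M.output q))

/-- Distinct automata have distinct descriptions. -/
theorem code_injective : Function.Injective (code (k := k)) := by
  rintro ⟨n, s, δ, o⟩ ⟨n', s', δ', o'⟩ h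
  simp only [code, Prod.mk.injEq] at h
  obtain ⟨h1, h2⟩ := h
  obtain rfl : n = n' := by simpa using congrArg List.length h2
  have h3 := List.ofFn_injective h2
  obtain rfl : s = s' := Fin.ext h1
  have h4 : δ = δ' := by
    funext q a
    have := List.ofFn_injective (Prod.ext_iff.1 (congrFun h3 q)).1
    exact Fin.ext (congrFun this a)
  have h5 : o = o' := by
    funext q
    exact (Prod.ext_iff.1 (congrFun h3 q)).2
  subst h4 h5
  rfl

/-- A property of automata is decidable if the set of descriptions of the automata that have the
property is decidable, i.e. its characteristic function is a total recursive function. -/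
def IsDecidable (P : DFAO k → Prop) : Prop :=
  ComputablePred fun c : ℕ × List (List ℕ × ℕ) => ∃ M : DFAO k, M.code = c ∧ P M

end DFAO

/-- The factor `x[i..i+n-1]` of length `n` beginning at position `i`. -/
def factor {α : Type*} (x : ℕ → α) (i n : ℕ) : List α :=
  (List.range n).map fun t => x (i + t)

/-- `w` is a fractional power with exponent `e`: it can be written as `u^n u'` with `n ≥ 1` and
`u'` a prefix of the nonempty word `u`, where `e = |w| / |u|`. -/
def IsFractionalPower {α : Type*} (w : List α) (e : ℚ) : Prop :=
  ∃ (u u' : List α) (n : ℕ), u ≠ [] ∧ 1 ≤ n ∧ u' <+: u ∧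
    w = (List.replicate n u).flatten ++ u' ∧ e = (w.length : ℚ) / (u.length : ℚ)

/-- The exponent of a word: the largest `e` such that the word is a fractional power with
exponent `e` (and `0` for the empty word, which is no fractional power). -/
noncomputable def wordExponent {α : Type*} (w : List α) : ℝ≥0∞ :=
  ⨆ (e : ℚ) (_ : IsFractionalPower w e), ENNReal.ofReal (e : ℝ)

/-- The critical exponent of `x`: the supremum of the exponents of its finite factors. -/
noncomputable def criticalExponent {α : Type*} (x : ℕ → α) : ℝ≥0∞ :=
  ⨆ (i : ℕ) (n : ℕ), wordExponent (factor x i n)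

/-- `x` contains fractional powers of arbitrarily large exponent. -/
def HasArbitrarilyLargePowers {α : Type*} (x : ℕ → α) : Prop :=
  ∀ C : ℚ, ∃ (i n : ℕ) (e : ℚ), C ≤ e ∧ IsFractionalPower (factor x i n) e

/-- `w` is bordered: it begins and ends with the same word `u`, where `0 < |u| ≤ |w| / 2`. -/
def IsBordered {α : Type*} (w : List α) : Prop :=
  ∃ u : List α, 0 < u.length ∧ 2 * u.length ≤ w.length ∧ u <+: w ∧ u <:+ w

/-- `x` contains arbitrarily long unbordered factors. -/
def HasArbitrarilyLongUnbordered {α : Type*} (x : ℕ → α) : Prop :=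
  ∀ N : ℕ, ∃ i n : ℕ, N ≤ n ∧ ¬ IsBordered (factor x i n)

/-! Formulas built by first-order logic from order, addition and the relation x(a) = x(b) are
decidable for automatic x. In base k each atomic relation is recognised by a finite automaton that
reads all variables in parallel; Boolean operations use products, an existential quantifier the
subset construction (`HasIndex.ex`). No automaton for a formula is built: only a bound N on its
number of states is kept. By `HasIndex.pumping`, if the parameters are below k^L, then a witness
exists only if one exists below k^(L+N), so a bounded search settles each quantifier
(`UniformlyAutomatic.ex`).

Having long unbordered factors is such a formula, because a border is a period. Having large powers
is not visibly one, since it compares a length with C p for variable C and p. But pumping the length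
while p stays fixed shows that one power of sufficiently large exponent forces arbitrarily long
factors with the same period p (`DFAO.hasArbitrarilyLargePowers_iff`), and the existence of such a p
is a formula. -/

/-- The valuation that maps `0` to `y` and `i + 1` to `v i`. -/
def consVal (y : ℕ) (v : ℕ → ℕ) : ℕ → ℕ
  | 0 => y
  | i + 1 => v i

theorem consVal_map (f : ℕ → ℕ) (y : ℕ) (v : ℕ → ℕ) :
    (fun i => f (consVal y v i)) = consVal (f y) (fun i => f (v i)) := by
  funext i
  cases i <;> rfl

/-! ### Relations of finite index in base k, and pumping -/

/-- A relation on valuations has index at most `N` in base `k` if it is saturated by a map to a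
set of at most `N` classes such that the class of `v` depends only on the last digits of the
values of `v` and on the class of the valuation obtained by deleting these digits. -/
def HasIndex (k N : ℕ) (R : (ℕ → ℕ) → Prop) : Prop :=
  ∃ (T : Type) (_ : Fintype T) (c : (ℕ → ℕ) → T), Fintype.card T ≤ N ∧
    (∀ v w, (∀ i, v i % k = w i % k) → c (fun i => v i / k) = c (fun i => w i / k) →
      c v = c w) ∧
    ∀ v w, c v = c w → (R v ↔ R w)

namespace HasIndex

variable {k N N' : ℕ} {R R' : (ℕ → ℕ) → Prop}

protected theorem not (h : HasIndex k N R) : HasIndex k N (fun v => ¬ R v) := by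
  obtain ⟨T, _, c, hT, hc, hR⟩ := h
  exact ⟨T, _, c, hT, hc, fun v w e => not_congr (hR v w e)⟩

protected theorem and (h : HasIndex k N R) (h' : HasIndex k N' R') :
    HasIndex k (N * N') (fun v => R v ∧ R' v) := by
  obtain ⟨T, _, c, hT, hc, hR⟩ := h
  obtain ⟨T', _, c', hT', hc', hR'⟩ := h'
  refine ⟨T × T', inferInstance, fun v => (c v, c' v), ?_, ?_, ?_⟩
  · rw [Fintype.card_prod]
    exact Nat.mul_le_mul hT hT'
  · intro v w e e'
    simp only [Prod.mk.injEq] at e' ⊢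
    exact ⟨hc v w e e'.1, hc' v w e e'.2⟩
  · intro v w e
    simp only [Prod.mk.injEq] at e
    exact and_congr (hR v w e.1) (hR' v w e.2)

/-- Subset construction: the class of v is the set of classes of all its extensions by some y. The
last digit of y can be chosen freely, so this set is determined by the last digits of v and the set
for the quotients. -/
protected theorem ex (hk : 0 < k) (h : HasIndex k N R) :
    HasIndex k (2 ^ N) (fun v => ∃ y, R (consVal y v)) := by
  obtain ⟨T, _, c, hT, hc, hR⟩ := h
  refine ⟨Set T, inferInstance, fun v => Set.range fun y => c (consVal y v), ?_, ?_, ?_⟩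
  · rw [Fintype.card_set]
    exact Nat.pow_le_pow_right (by norm_num) hT
  · have key : ∀ v w : ℕ → ℕ, (∀ i, v i % k = w i % k) →
        (Set.range fun y => c (consVal y fun i => v i / k)) ⊆
          (Set.range fun y => c (consVal y fun i => w i / k)) →
        (Set.range fun y => c (consVal y v)) ⊆ Set.range fun y => c (consVal y w) := by
      rintro v w e e' _ ⟨y, rfl⟩
      obtain ⟨z, hz⟩ := e' ⟨y / k, rfl⟩
      refine ⟨z * k + y % k, hc _ _ ?_ ?_⟩
      · rintro (_ | i)
        · simp [consVal]
        · exact (e i).symm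
      · rw [consVal_map (· / k), consVal_map (· / k)]
        have : (z * k + y % k) / k = z := by
          rw [add_comm, Nat.add_mul_div_right _ _ hk, Nat.div_eq_of_lt (Nat.mod_lt _ hk), zero_add]
        rw [this]
        exact hz
    intro v w e e'
    exact (key v w e e'.subset).antisymm (key w v (fun i => (e i).symm) e'.symm.subset)
  · have key : ∀ v w : ℕ → ℕ, (Set.range fun y => c (consVal y v)) ⊆
        (Set.range fun y => c (consVal y w)) → (∃ y, R (consVal y v)) →
        ∃ y, R (consVal y w) := by
      rintro v w e ⟨y, hy⟩
      obtain ⟨z, hz⟩ := e ⟨y, rfl⟩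
      exact ⟨z, (hR _ _ hz).2 hy⟩
    intro v w e
    exact ⟨key v w e.subset, key w v e.symm.subset⟩

/-- The relation `v i ≤ v j` has index at most four. -/
theorem le (i j : ℕ) (hk : 0 < k) : HasIndex k 4 (fun v => v i ≤ v j) := by
  refine ⟨Bool × Bool, inferInstance, fun v => (decide (v i ≤ v j), decide (v j ≤ v i)),
    by simp, ?_, ?_⟩
  -- The last digits matter only when the quotients agree, so both comparisons of the quotients must
  -- be recorded.
  · have key : ∀ a b : ℕ, a ≤ b ↔ a / k ≤ b / k ∧ (b / k ≤ a / k → a % k ≤ b % k) := by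
      intro a b
      have ha := Nat.div_add_mod a k
      have hb := Nat.div_add_mod b k
      have ha' := Nat.mod_lt a hk
      have hb' := Nat.mod_lt b hk
      constructor
      · intro h
        have h1 : a / k ≤ b / k := Nat.div_le_div_right h
        refine ⟨h1, fun h2 => ?_⟩
        rw [le_antisymm h1 h2] at ha
        omega
      · rintro ⟨h1, h2⟩
        rcases h1.lt_or_eq with h | h
        · have := Nat.mul_le_mul_left k h
          rw [Nat.succ_eq_add_one, mul_add] at this
          omega
        · have := h2 h.ge
          rw [h] at ha
          omega
    intro v w e e'
    simp only [Prod.mk.injEq, decide_eq_decide] at e' ⊢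
    rw [key (v i), key (v j), key (w i), key (w j), e i, e j, e'.1, e'.2]
    exact ⟨Iff.rfl, Iff.rfl⟩
  · intro v w e
    simp only [Prod.mk.injEq, decide_eq_decide] at e
    exact e.1

/-- The relation `v i + v j = v l` has index at most four. -/
theorem add (i j l : ℕ) (hk : 2 ≤ k) : HasIndex k 4 (fun v => v i + v j = v l) := by
  refine ⟨Bool × Bool, inferInstance,
    fun v => (decide (v i + v j = v l), decide (v i + v j + 1 = v l)), by simp, ?_, ?_⟩
  -- Here t is the carry into the sum; the second alternative is the case where the last digits pass
  -- a carry on to the quotients.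
  · have key : ∀ a b e t : ℕ, t ≤ 1 → (a + b + t = e ↔
        (a / k + b / k = e / k ∧ a % k + b % k + t = e % k) ∨
        (a / k + b / k + 1 = e / k ∧ a % k + b % k + t = e % k + k)) := by
      intro a b e t ht
      have ha := Nat.div_add_mod a k
      have hb := Nat.div_add_mod b k
      have he := Nat.div_add_mod e k
      have ha' := Nat.mod_lt a (show 0 < k by omega)
      have hb' := Nat.mod_lt b (show 0 < k by omega)
      have he' := Nat.mod_lt e (show 0 < k by omega)
      generalize a / k = A at *
      generalize b / k = B at *
      generalize e / k = E at *
      generalize a % k = a0 at *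
      generalize b % k = b0 at *
      generalize e % k = e0 at *
      subst ha hb he
      constructor
      · intro h
        have h1 : A + B ≤ E := by
          by_contra hlt
          have := Nat.mul_le_mul_left k (show E + 1 ≤ A + B by omega)
          rw [mul_add, mul_add] at this
          omega
        have h2 : E ≤ A + B + 1 := by
          by_contra hlt
          have := Nat.mul_le_mul_left k (show A + B + 2 ≤ E by omega)
          rw [mul_add, mul_add] at this
          omega
        rcases (show A + B = E ∨ A + B + 1 = E by omega) with h3 | h3
        · subst h3
          rw [mul_add] at h
          left; omega
        · subst h3
          rw [mul_add, mul_add] at h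
          right; omega
      · rintro (⟨rfl, h2⟩ | ⟨rfl, h2⟩)
        · rw [mul_add]; omega
        · rw [mul_add, mul_add]; omega
    intro v w e e'
    simp only [Prod.mk.injEq, decide_eq_decide] at e' ⊢
    have k0 := fun v : ℕ → ℕ => key (v i) (v j) (v l) 0 (by norm_num)
    have k1 := fun v : ℕ → ℕ => key (v i) (v j) (v l) 1 le_rfl
    simp only [add_zero] at k0
    rw [k0, k0, k1, k1, e i, e j, e l, e'.1, e'.2]
    exact ⟨Iff.rfl, Iff.rfl⟩
  · intro v w e
    simp only [Prod.mk.injEq, decide_eq_decide] at e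
    exact e.1

/-- If `y` is so large that it has more than `N` leading digits to which no digit of `v`
corresponds, then it can be replaced by smaller and by larger numbers. -/
theorem pumping (hk : 2 ≤ k) (h : HasIndex k N R) {v : ℕ → ℕ} {L y : ℕ}
    (hv : ∀ i, v i < k ^ L) (hy : k ^ (L + N) ≤ y) :
    (∃ z < y, R (consVal z v) ↔ R (consVal y v)) ∧
      ∃ z > y, R (consVal z v) ↔ R (consVal y v) := by
  obtain ⟨T, _, c, hT, hc, hR⟩ := h
  have hpos : ∀ j, 0 < k ^ j := fun j => Nat.pow_pos (by omega)
  have iter : ∀ j (v w : ℕ → ℕ), (∀ i, v i % k ^ j = w i % k ^ j) →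
      c (fun i => v i / k ^ j) = c (fun i => w i / k ^ j) → c v = c w := by
    intro j
    induction j with
    | zero => intro v w _ e; simpa using e
    | succ j ih =>
      intro v w e e'
      refine ih v w (fun i => ?_) (hc _ _ (fun i => ?_) ?_)
      · have := congrArg (· % k ^ j) (e i)
        simpa [Nat.mod_mod_of_dvd _ (pow_dvd_pow k j.le_succ)] using this
      · have := congrArg (· / k ^ j) (e i)
        simpa only [pow_succ, Nat.mod_mul_right_div_self] using this
      · simpa only [Nat.div_div_eq_div_mul, ← pow_succ] using e'
  have hzero : ∀ j, L ≤ j → (fun i => v i / k ^ j) = fun _ => 0 := fun j hj => by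
    funext i
    exact Nat.div_eq_of_lt ((hv i).trans_le (Nat.pow_le_pow_right (by omega) hj))
  have swap : ∀ a b, L ≤ a → c (consVal (y / k ^ a) fun _ => 0) = c (consVal b fun _ => 0) →
      (R (consVal (b * k ^ a + y % k ^ a) v) ↔ R (consVal y v)) := by
    intro a b ha e
    refine hR _ _ (iter a _ _ ?_ ?_)
    · rintro (_ | i)
      · simp [consVal]
      · rfl
    · rw [consVal_map (· / k ^ a), consVal_map (· / k ^ a), hzero a ha, e, add_comm,
        Nat.add_mul_div_right _ _ (hpos a), Nat.div_eq_of_lt (Nat.mod_lt _ (hpos a)), zero_add]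
  -- Pigeonhole on the N + 1 leading parts of y above position L, where all digits of v are zero.
  obtain ⟨s, t, hst, e⟩ : ∃ s t : Fin (N + 1), s < t ∧
      c (consVal (y / k ^ (L + s)) fun _ => 0) = c (consVal (y / k ^ (L + t)) fun _ => 0) := by
    obtain ⟨s, t, hne, e⟩ := Fintype.exists_ne_map_eq_of_card_lt
      (fun s : Fin (N + 1) => c (consVal (y / k ^ (L + s)) fun _ => 0))
      (by rw [Fintype.card_fin]; omega)
    rcases hne.lt_or_gt with h | h
    · exact ⟨s, t, h, e⟩
    · exact ⟨t, s, h, e.symm⟩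
  have hlt : y / k ^ (L + t) < y / k ^ (L + s) := by
    have h1 : 0 < y / k ^ (L + t) :=
      Nat.div_pos ((Nat.pow_le_pow_right (by omega) (by omega)).trans hy) (hpos _)
    have h2 : k ^ (L + t) = k ^ (L + s) * k ^ (t - s : ℕ) := by
      rw [← pow_add]
      congr 1
      have := Fin.lt_def.1 hst
      omega
    rw [h2, ← Nat.div_div_eq_div_mul] at h1 ⊢
    refine Nat.div_lt_self (by by_contra h0; simp [Nat.le_zero.1 (not_lt.1 h0)] at h1) ?_
    exact Nat.one_lt_pow (by have := Fin.lt_def.1 hst; omega) (by omega)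
  -- Putting the shorter leading part in place of the longer one gives a smaller number, the
  -- converse a larger one.
  refine ⟨⟨_, ?_, swap (L + s) _ (by omega) e⟩, ⟨_, ?_, swap (L + t) _ (by omega) e.symm⟩⟩
  · conv_rhs => rw [← Nat.div_add_mod' y (k ^ (L + s))]
    exact Nat.add_lt_add_right (Nat.mul_lt_mul_of_pos_right hlt (hpos _)) _
  · conv_rhs => rw [← Nat.div_add_mod' y (k ^ (L + t))]
    exact Nat.add_lt_add_right (Nat.mul_lt_mul_of_pos_right hlt (hpos _)) _

theorem exists_iff_exists_lt (hk : 2 ≤ k) (h : HasIndex k N R) {v : ℕ → ℕ} {L : ℕ}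
    (hv : ∀ i, v i < k ^ L) :
    (∃ y, R (consVal y v)) ↔ ∃ y < k ^ (L + N), R (consVal y v) := by
  classical
  refine ⟨fun hex => ⟨Nat.find hex, ?_, Nat.find_spec hex⟩, fun ⟨y, _, hy⟩ => ⟨y, hy⟩⟩
  by_contra hle
  obtain ⟨z, hz, e⟩ := (h.pumping hk hv (not_lt.1 hle)).1
  exact Nat.find_min hex hz (e.2 (Nat.find_spec hex))

theorem exists_ge_of_large (hk : 2 ≤ k) (h : HasIndex k N R) {v : ℕ → ℕ} {L y : ℕ}
    (hv : ∀ i, v i < k ^ L) (hy : k ^ (L + N) ≤ y) (hR : R (consVal y v)) (B : ℕ) :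
    ∃ z ≥ B, R (consVal z v) := by
  have : ∀ B, ∃ z ≥ B, k ^ (L + N) ≤ z ∧ R (consVal z v) := by
    intro B
    induction B with
    | zero => exact ⟨y, Nat.zero_le _, hy, hR⟩
    | succ B ih =>
      obtain ⟨z, hz, hz', hzR⟩ := ih
      obtain ⟨u, hu, e⟩ := (h.pumping hk hv hz').2
      exact ⟨u, by omega, by omega, e.2 hzR⟩
  obtain ⟨z, hz, -, hzR⟩ := this B
  exact ⟨z, hz, hzR⟩

end HasIndex

/-! ### Equality of terms of an automatic sequence -/

theorem canonicalRep_of_pos {k : ℕ} (hk : 2 ≤ k) {n : ℕ} (hn : 0 < n) :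
    canonicalRep k hk n = canonicalRep k hk (n / k) ++ [⟨n % k, Nat.mod_lt _ (by omega)⟩] := by
  simp [canonicalRep, Nat.digits_def' (show 1 < k by omega) hn]

namespace DFAO

variable {k : ℕ}

theorem run_canonicalRep_of_pos (M : DFAO k) (hk : 2 ≤ k) {n : ℕ} (hn : 0 < n) :
    M.run (canonicalRep k hk n) =
      M.step (M.run (canonicalRep k hk (n / k))) ⟨n % k, Nat.mod_lt _ (by omega)⟩ := by
  rw [canonicalRep_of_pos hk hn, run, List.foldl_append]
  rfl

/-- Equality of two terms of the sequence generated by `M` has index at most `(2 s)²`, where `s`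
is the number of states. -/
theorem hasIndex_sequence_eq (M : DFAO k) (hk : 2 ≤ k) (i j : ℕ) :
    HasIndex k ((2 * M.numStates) * (2 * M.numStates))
      (fun v => M.sequence hk (v i) = M.sequence hk (v j)) := by
  -- The flag for n = 0 is needed because zero has the empty representation: appending the digit 0
  -- to it does not apply the transition, even if the same state at a positive number would move.
  let q : ℕ → Bool × Fin M.numStates := fun n => (decide (n = 0), M.run (canonicalRep k hk n))
  have key : ∀ m n, m % k = n % k → q (m / k) = q (n / k) → q m = q n := by
    intro m n e e'
    simp only [q, Prod.mk.injEq, decide_eq_decide] at e' ⊢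
    have h0 : ∀ n, n = 0 ↔ n / k = 0 ∧ n % k = 0 := by
      intro n
      refine ⟨fun h => by simp [h], fun ⟨h1, h2⟩ => ?_⟩
      rw [← Nat.div_add_mod n k, h1, h2, mul_zero]
    have h : m = 0 ↔ n = 0 := by rw [h0 m, h0 n, e, e'.1]
    refine ⟨h, ?_⟩
    rcases Nat.eq_zero_or_pos m with hm | hm
    · rw [hm, h.1 hm]
    · have hn : 0 < n := Nat.pos_of_ne_zero fun hn => hm.ne' (h.2 hn)
      rw [M.run_canonicalRep_of_pos hk hm, M.run_canonicalRep_of_pos hk hn, e'.2]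
      congr 2
  refine ⟨(Bool × Fin M.numStates) × (Bool × Fin M.numStates), inferInstance,
    fun v => (q (v i), q (v j)), by simp, ?_, ?_⟩
  · intro v w e e'
    rw [Prod.mk.injEq] at e' ⊢
    exact ⟨key _ _ (e i) e'.1, key _ _ (e j) e'.2⟩
  · intro v w e
    simp only [q, Prod.mk.injEq] at e
    simp only [sequence]
    rw [e.1.2, e.2.2]

end DFAO

/-! ### Primitive recursive evaluation of coded automata -/

/-- The state reached by the automaton with description `c` on the base-`k` representation
of `n`. -/
def codeState {k : ℕ} (hk : 2 ≤ k) (c : ℕ × List (List ℕ × ℕ)) (n : ℕ) : ℕ :=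
  if _h : n = 0 then c.1
  -- The default values are never used when c describes an automaton over k letters.
  else (c.2.getD (codeState hk c (n / k)) ([], 0)).1.getD (n % k) 0
termination_by n
decreasing_by exact Nat.div_lt_self (Nat.pos_of_ne_zero _h) (by omega)

/-- The `n`-th term of the sequence generated by the automaton with description `c`. -/
def codeSequence {k : ℕ} (hk : 2 ≤ k) (c : ℕ × List (List ℕ × ℕ)) (n : ℕ) : ℕ :=
  (c.2.getD (codeState hk c n) ([], 0)).2

theorem DFAO.codeState_code {k : ℕ} (hk : 2 ≤ k) (M : DFAO k) (n : ℕ) :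
    codeState hk M.code n = (M.run (canonicalRep k hk n) : ℕ) := by
  induction n using Nat.strong_induction_on with
  | _ n ih =>
    rw [codeState]
    split_ifs with h
    · subst h
      simp [canonicalRep, run, code]
    · have hn := Nat.pos_of_ne_zero h
      rw [ih _ (Nat.div_lt_self hn (by omega)), M.run_canonicalRep_of_pos hk hn]
      have := Nat.mod_lt n (show 0 < k by omega)
      simp [code, List.getD_eq_getElem?_getD, this]

theorem DFAO.codeSequence_code {k : ℕ} (hk : 2 ≤ k) (M : DFAO k) (n : ℕ) :
    codeSequence hk M.code n = M.sequence hk n := by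
  rw [codeSequence, M.codeState_code hk]
  simp [code, List.getD_eq_getElem?_getD, sequence]

theorem primrec_codeState {k : ℕ} (hk : 2 ≤ k) : Primrec₂ (codeState hk) := by
  -- Course-of-values recursion: the list holds the states for all smaller numbers, so its length is
  -- the current n.
  have hnext : Primrec fun p : (ℕ × List (List ℕ × ℕ)) × List ℕ =>
      if p.2.length = 0 then p.1.1
      else (p.1.2.getD (p.2.getD (p.2.length / k) 0) ([], 0)).1.getD (p.2.length % k) 0 := by
    have hlen : Primrec fun p : (ℕ × List (List ℕ × ℕ)) × List ℕ => p.2.length :=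
      Primrec.list_length.comp Primrec.snd
    refine Primrec.ite (Primrec.eq.comp hlen (Primrec.const 0))
      (Primrec.fst.comp Primrec.fst) ?_
    refine (Primrec.list_getD 0).comp (Primrec.fst.comp ((Primrec.list_getD ([], 0)).comp
      (Primrec.snd.comp Primrec.fst) ?_)) (Primrec.nat_mod.comp hlen (Primrec.const k))
    exact (Primrec.list_getD 0).comp Primrec.snd (Primrec.nat_div.comp hlen (Primrec.const k))
  refine Primrec.nat_strong_rec _ (Primrec.option_some.comp hnext).to₂ fun c n => ?_
  rw [Option.some_inj, codeState]
  by_cases h : n = 0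
  · simp [h]
  · have := Nat.div_lt_self (Nat.pos_of_ne_zero h) (show 1 < k by omega)
    simp [h, List.getD_eq_getElem?_getD, this]

theorem primrec_codeSequence {k : ℕ} (hk : 2 ≤ k) : Primrec₂ (codeSequence hk) :=
  (Primrec.snd.comp ((Primrec.list_getD ([], 0)).comp (Primrec.snd.comp Primrec.fst)
    (primrec_codeState hk))).to₂

theorem primrec_const_pow (b : ℕ) : Primrec fun n : ℕ => b ^ n :=
  (Primrec.nat_rec₁ 1 (Primrec.nat_mul.comp Primrec.snd (Primrec.const b)).to₂).of_eq fun n => by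
    induction n with
    | zero => rfl
    | succ n ih => rw [pow_succ, ← ih]

theorem primrec_list_sum : Primrec (List.sum : List ℕ → ℕ) :=
  (Primrec.list_foldr .id (Primrec.const 0)
    (Primrec.nat_add.comp (Primrec.fst.comp Primrec.snd)
      (Primrec.snd.comp Primrec.snd)).to₂).of_eq fun l => by
    induction l with
    | nil => rfl
    | cons a l ih => simpa using ih

/-- The valuation given by the list of its first values, all others being zero. -/
def listVal (l : List ℕ) (i : ℕ) : ℕ := l.getD i 0

theorem listVal_cons (y : ℕ) (l : List ℕ) : listVal (y :: l) = consVal y (listVal l) := by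
  funext i
  cases i <;> rfl

theorem listVal_lt_pow {k : ℕ} (hk : 2 ≤ k) (l : List ℕ) (i : ℕ) :
    listVal l i < k ^ l.sum := by
  refine lt_of_le_of_lt ?_ (Nat.lt_pow_self (show 1 < k by omega))
  rw [listVal, List.getD_eq_getElem?_getD]
  rcases lt_or_ge i l.length with h | h
  · rw [List.getElem?_eq_getElem h]
    exact List.le_sum_of_mem (List.getElem_mem h)
  · simp [List.getElem?_eq_none h]

theorem primrec_listVal (i : ℕ) : Primrec fun l => listVal l i :=
  (Primrec.list_getD 0).comp .id (Primrec.const i)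

/-! ### Uniformly automatic relations and the decision procedure -/

/-- A relation between a sequence and a valuation is uniformly automatic if for `k`-automatic
sequences its index is bounded by a primitive recursive function of the automaton and the relation
is primitive recursive in the automaton and the valuation. -/
def UniformlyAutomatic {k : ℕ} (hk : 2 ≤ k) (R : (ℕ → ℕ) → (ℕ → ℕ) → Prop) : Prop :=
  ∃ N : ℕ × List (List ℕ × ℕ) → ℕ, Primrec N ∧
    ∃ D : (ℕ × List (List ℕ × ℕ)) × List ℕ → Prop, PrimrecPred D ∧
      ∀ M : DFAO k, HasIndex k (N M.code) (R (M.sequence hk)) ∧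
        ∀ l, D (M.code, l) ↔ R (M.sequence hk) (listVal l)

namespace UniformlyAutomatic

variable {k : ℕ} {hk : 2 ≤ k} {R R' : (ℕ → ℕ) → (ℕ → ℕ) → Prop}

theorem sequence_eq (i j : ℕ) : UniformlyAutomatic hk fun x v => x (v i) = x (v j) := by
  refine ⟨fun c => (2 * c.2.length) * (2 * c.2.length), ?_,
    fun p => codeSequence hk p.1 (listVal p.2 i) = codeSequence hk p.1 (listVal p.2 j), ?_,
    fun M => ⟨?_, fun l => ?_⟩⟩
  · have : Primrec fun c : ℕ × List (List ℕ × ℕ) => 2 * c.2.length :=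
      Primrec.nat_mul.comp (Primrec.const 2) (Primrec.list_length.comp Primrec.snd)
    exact Primrec.nat_mul.comp this this
  · have : ∀ i, Primrec fun p : (ℕ × List (List ℕ × ℕ)) × List ℕ =>
        codeSequence hk p.1 (listVal p.2 i) := fun i =>
      (primrec_codeSequence hk).comp Primrec.fst ((primrec_listVal i).comp Primrec.snd)
    exact Primrec.eq.comp (this i) (this j)
  · simpa [DFAO.code] using M.hasIndex_sequence_eq hk i j
  · simp only [M.codeSequence_code hk]

theorem le (i j : ℕ) : UniformlyAutomatic hk fun _ v => v i ≤ v j :=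
  ⟨fun _ => 4, Primrec.const 4, fun p => listVal p.2 i ≤ listVal p.2 j,
    Primrec.nat_le.comp ((primrec_listVal i).comp Primrec.snd)
      ((primrec_listVal j).comp Primrec.snd),
    fun _ => ⟨HasIndex.le i j (by omega), fun _ => Iff.rfl⟩⟩

theorem add (i j m : ℕ) : UniformlyAutomatic hk fun _ v => v i + v j = v m :=
  ⟨fun _ => 4, Primrec.const 4, fun p => listVal p.2 i + listVal p.2 j = listVal p.2 m,
    Primrec.eq.comp (Primrec.nat_add.comp ((primrec_listVal i).comp Primrec.snd)
      ((primrec_listVal j).comp Primrec.snd)) ((primrec_listVal m).comp Primrec.snd),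
    fun _ => ⟨HasIndex.add i j m hk, fun _ => Iff.rfl⟩⟩

protected theorem congr (h : UniformlyAutomatic hk R) (e : ∀ x v, R x v ↔ R' x v) :
    UniformlyAutomatic hk R' := by
  rwa [← show R = R' from funext fun x => funext fun v => propext (e x v)]

protected theorem not (h : UniformlyAutomatic hk R) :
    UniformlyAutomatic hk fun x v => ¬ R x v := by
  obtain ⟨N, hN, D, hD, h⟩ := h
  exact ⟨N, hN, _, hD.not, fun M => ⟨(h M).1.not, fun l => not_congr ((h M).2 l)⟩⟩

protected theorem and (h : UniformlyAutomatic hk R) (h' : UniformlyAutomatic hk R') :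
    UniformlyAutomatic hk fun x v => R x v ∧ R' x v := by
  obtain ⟨N, hN, D, hD, h⟩ := h
  obtain ⟨N', hN', D', hD', h'⟩ := h'
  exact ⟨_, Primrec.nat_mul.comp hN hN', _, hD.and hD',
    fun M => ⟨(h M).1.and (h' M).1, fun l => and_congr ((h M).2 l) ((h' M).2 l)⟩⟩

protected theorem imp (h : UniformlyAutomatic hk R) (h' : UniformlyAutomatic hk R') :
    UniformlyAutomatic hk fun x v => R x v → R' x v := by
  simpa only [not_and_not_right] using (h.and h'.not).not

protected theorem ex (h : UniformlyAutomatic hk R) :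
    UniformlyAutomatic hk fun x v => ∃ y, R x (consVal y v) := by
  obtain ⟨N, hN, D, hD, h⟩ := h
  -- All parameters are below k to the power of their sum, which serves as L in the bound on the
  -- least witness.
  refine ⟨_, (primrec_const_pow 2).comp hN,
    fun p => ∃ y < k ^ (p.2.sum + N p.1), D (p.1, y :: p.2), ?_,
    fun M => ⟨(h M).1.ex (by omega), fun l => ?_⟩⟩
  · have hrel : PrimrecRel fun (y : ℕ) (p : (ℕ × List (List ℕ × ℕ)) × List ℕ) =>
        D (p.1, y :: p.2) :=
      hD.comp (Primrec.pair (Primrec.fst.comp Primrec.snd)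
        (Primrec.list_cons.comp Primrec.fst (Primrec.snd.comp Primrec.snd)))
    exact (hrel.exists_mem_list.comp (Primrec.list_range.comp ((primrec_const_pow k).comp
      (Primrec.nat_add.comp (primrec_list_sum.comp Primrec.snd) (hN.comp Primrec.fst))))
      Primrec.id).of_eq fun p => by simp
  · beta_reduce
    rw [(h M).1.exists_iff_exists_lt hk (listVal_lt_pow hk l)]
    simp only [(h M).2, listVal_cons]

protected theorem all (h : UniformlyAutomatic hk R) :
    UniformlyAutomatic hk fun x v => ∀ y, R x (consVal y v) := by
  simpa only [not_exists, not_not] using h.not.ex.not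

/-- A property of sequences that is uniformly automatic is decidable for automatic sequences. -/
theorem isDecidable {P : (ℕ → ℕ) → Prop} (h : UniformlyAutomatic hk fun x _ => P x) :
    DFAO.IsDecidable fun M : DFAO k => P (M.sequence hk) := by
  obtain ⟨N, -, D, hD, h⟩ := h
  have hlen : Primrec fun c : ℕ × List (List ℕ × ℕ) => c.2.length :=
    Primrec.list_length.comp Primrec.snd
  have hentries : PrimrecRel fun (l : List ℕ) (c : ℕ × List (List ℕ × ℕ)) =>
      ∀ a ∈ l, a < c.2.length :=
    PrimrecRel.forall_mem_list (R := fun (a : ℕ) (c : ℕ × List (List ℕ × ℕ)) => a < c.2.length)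
      (Primrec.nat_lt.comp Primrec.fst (hlen.comp Primrec.snd))
  have hrow : PrimrecRel fun (r : List ℕ × ℕ) (c : ℕ × List (List ℕ × ℕ)) =>
      r.1.length = k ∧ ∀ a ∈ r.1, a < c.2.length :=
    PrimrecPred.and
      (Primrec.eq.comp (Primrec.list_length.comp (Primrec.fst.comp Primrec.fst))
        (Primrec.const k))
      (hentries.comp (Primrec.fst.comp Primrec.fst) Primrec.snd)
  -- Tables that describe no automaton must be rejected explicitly, because D is specified on codes
  -- only.
  have hvalid : PrimrecPred fun c : ℕ × List (List ℕ × ℕ) =>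
      c.1 < c.2.length ∧ ∀ r ∈ c.2, r.1.length = k ∧ ∀ a ∈ r.1, a < c.2.length :=
    PrimrecPred.and (Primrec.nat_lt.comp Primrec.fst hlen)
      (hrow.forall_mem_list.comp Primrec.snd .id)
  refine ComputablePred.of_eq (hvalid.and
    (hD.comp (Primrec.pair .id (Primrec.const [])))).computablePred fun c => ?_
  constructor
  · rintro ⟨⟨hs, hr⟩, hDc⟩
    have hcode : ∃ M : DFAO k, M.code = c := by
      have hr' := fun q : Fin c.2.length => hr _ (List.getElem_mem q.2)
      refine ⟨⟨c.2.length, ⟨c.1, hs⟩, fun q a => ⟨(c.2[q]).1[a]'?_, ?_⟩, fun q => (c.2[q]).2⟩, ?_⟩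
      · exact a.2.trans_eq (hr' q).1.symm
      · exact (hr' q).2 _ (List.getElem_mem _)
      · refine Prod.ext rfl (List.ext_getElem (by simp [DFAO.code]) fun i h1 h2 => ?_)
        have hi := (hr' ⟨i, h2⟩).1
        simp only [DFAO.code, List.getElem_ofFn]
        refine Prod.ext (List.ext_getElem (by simpa using hi.symm) fun j h3 h4 => ?_) rfl
        simp
    obtain ⟨M, rfl⟩ := hcode
    exact ⟨M, rfl, ((h M).2 []).1 hDc⟩
  · rintro ⟨M, rfl, hP⟩
    refine ⟨⟨?_, ?_⟩, ((h M).2 []).2 hP⟩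
    · simp [DFAO.code]
    · intro r hr
      simp only [DFAO.code, List.mem_ofFn] at hr
      obtain ⟨q, rfl⟩ := hr
      simp only [List.length_ofFn, List.mem_ofFn, true_and, DFAO.code]
      rintro a ⟨d, rfl⟩
      exact (M.step q d).2

end UniformlyAutomatic

/-! ### Powers and borders as periods -/

section Factor

variable {α : Type*} (x : ℕ → α)

@[simp]
theorem length_factor (i n : ℕ) : (factor x i n).length = n := by simp [factor]

theorem factor_add (i m n : ℕ) : factor x i (m + n) = factor x i m ++ factor x (i + m) n := by
  simp [factor, List.range_add, Function.comp_def, add_assoc]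

variable {x}

theorem factor_eq_factor_iff {i j n : ℕ} :
    factor x i n = factor x j n ↔ ∀ t < n, x (i + t) = x (j + t) := by
  simp [factor]

theorem append_eq_factor {u r : List α} {i n : ℕ} (h : u ++ r = factor x i n) :
    n = u.length + r.length ∧ u = factor x i u.length ∧
      r = factor x (i + u.length) r.length := by
  have hn : n = u.length + r.length := by simpa using (congrArg List.length h).symm
  rw [hn, factor_add] at h
  exact ⟨hn, List.append_inj h (by simp)⟩

/-- Deleting the first copy of u leaves a word that is also a prefix of the factor; comparing the
two occurrences gives the period |u|. -/
theorem IsFractionalPower.exists_period {i n : ℕ} {e : ℚ}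
    (h : IsFractionalPower (factor x i n) e) :
    ∃ p, 1 ≤ p ∧ p ≤ n ∧ e = n / p ∧ ∀ t < n - p, x (i + t) = x (i + t + p) := by
  obtain ⟨u, u', m, hu, hm, hu', hw, he⟩ := h
  obtain ⟨m, rfl⟩ := Nat.exists_eq_add_of_le' hm
  have hpre : (List.replicate m u).flatten ++ u' <+: factor x i n := by
    rw [hw, List.replicate_succ', List.flatten_concat, List.append_assoc,
      List.prefix_append_right_inj]
    exact hu'.trans (List.prefix_append _ _)
  rw [List.replicate_succ, List.flatten_cons, List.append_assoc] at hw
  obtain ⟨r, hr⟩ := hpre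
  obtain ⟨hn, -, h1⟩ := append_eq_factor hw.symm
  obtain ⟨-, h2, -⟩ := append_eq_factor hr
  refine ⟨u.length, List.length_pos_of_ne_nil hu, by omega, by simpa using he, ?_⟩
  rw [show n - u.length = ((List.replicate m u).flatten ++ u').length by omega]
  intro t ht
  rw [factor_eq_factor_iff.1 (h2.symm.trans h1) t ht, add_right_comm]

theorem factor_eq_flatten_replicate {i p m : ℕ} (h : ∀ t < p * m, x (i + t) = x (i + t + p)) :
    factor x i (p * m) = (List.replicate m (factor x i p)).flatten := by
  induction m with
  | zero => simp [factor]
  | succ m ih =>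
    have h' : ∀ t < p * m, x (i + t) = x (i + t + p) := fun t ht =>
      h t (ht.trans_le (Nat.mul_le_mul_left p m.le_succ))
    rw [List.replicate_succ, List.flatten_cons, ← ih h', mul_add, mul_one, add_comm (p * m) p,
      factor_add]
    congr 1
    refine factor_eq_factor_iff.2 fun t ht => ?_
    rw [h' t ht, add_right_comm]

theorem isFractionalPower_of_period {i p m : ℕ} (hp : 1 ≤ p) (hm : 1 ≤ m)
    (h : ∀ t < p * m, x (i + t) = x (i + t + p)) :
    IsFractionalPower (factor x i (p * m)) m := by
  refine ⟨factor x i p, [], m, ?_, hm, List.nil_prefix, ?_, ?_⟩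
  · rw [← List.length_pos_iff_ne_nil, length_factor]
    omega
  · rw [List.append_nil, factor_eq_flatten_replicate h]
  · have : (p : ℚ) ≠ 0 := by positivity
    simp only [length_factor]
    push_cast
    field_simp

/-- A border u corresponds to the period s = n - |u|; the bound |u| ≤ n/2 becomes n ≤ 2s. -/
theorem isBordered_factor_iff {i n : ℕ} :
    IsBordered (factor x i n) ↔
      ∃ s, n ≤ s + s ∧ s < n ∧ ∀ t < n - s, x (i + t) = x (i + t + s) := by
  constructor
  · rintro ⟨u, hpos, hle, ⟨r, hr⟩, ⟨r', hr'⟩⟩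
    obtain ⟨hn, h1, -⟩ := append_eq_factor hr
    obtain ⟨hn', -, h2⟩ := append_eq_factor hr'
    rw [length_factor] at hle
    refine ⟨r'.length, by omega, by omega, ?_⟩
    rw [show n - r'.length = u.length by omega]
    intro t ht
    rw [factor_eq_factor_iff.1 (h1.symm.trans h2) t ht, add_right_comm]
  · rintro ⟨s, hns, hsn, h⟩
    refine ⟨factor x i (n - s), by simp; omega, by simp; omega,
      ⟨factor x (i + (n - s)) s, ?_⟩, ⟨factor x i s, ?_⟩⟩
    · rw [← factor_add, Nat.sub_add_cancel hsn.le]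
    · have : factor x i (n - s) = factor x (i + s) (n - s) :=
        factor_eq_factor_iff.2 fun t ht => by rw [h t ht, add_right_comm]
      rw [this, ← factor_add, Nat.add_sub_cancel' hsn.le]

theorem criticalExponent_eq_top_iff : criticalExponent x = ⊤ ↔ HasArbitrarilyLargePowers x := by
  simp only [criticalExponent, wordExponent, HasArbitrarilyLargePowers]
  constructor
  · intro h C
    have hlt : ENNReal.ofReal (C : ℝ) < ⊤ := ENNReal.ofReal_lt_top
    rw [← h] at hlt
    simp only [lt_iSup_iff] at hlt
    obtain ⟨i, n, e, he, hlt⟩ := hlt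
    refine ⟨i, n, e, ?_, he⟩
    exact_mod_cast (ENNReal.ofReal_lt_ofReal_iff'.1 hlt).1.le
  · intro h
    refine ENNReal.eq_top_of_forall_nnreal_le ?_
    intro r
    obtain ⟨C, hC⟩ := exists_rat_gt (r : ℝ)
    obtain ⟨i, n, e, hCe, he⟩ := h C
    refine le_trans ?_ (le_iSup_of_le i (le_iSup_of_le n (le_iSup₂_of_le e he le_rfl)))
    rw [← ENNReal.ofReal_coe_nnreal]
    exact ENNReal.ofReal_le_ofReal (hC.le.trans (by exact_mod_cast hCe))

end Factor

/-! ### The two properties as formulas -/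

namespace UniformlyAutomatic

variable {k : ℕ} (hk : 2 ≤ k)

/-- That `v 1` is a period of some factor of length `v 0 + v 1` is uniformly automatic. -/
theorem exists_period :
    UniformlyAutomatic hk fun x v => ∃ i, ∀ t < v 0, x (i + t) = x (i + t + v 1) := by
  -- De Bruijn indices: the innermost bound variable is 0. From outside in, the variables are i, e =
  -- i + v 0, a = i + t, b = a + v 1; sums need names because atomic formulas contain only
  -- variables.
  have h1 := ((add (hk := hk) 1 5 0).imp (sequence_eq 1 0)).all
  have h2 := ((le 2 0).imp ((le 1 0).not.imp h1)).all
  refine ((add 1 2 0).and h2).ex.ex.congr fun x v => ?_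
  simp only [consVal]
  constructor
  · rintro ⟨i, e, rfl, h⟩
    exact ⟨i, fun t ht => h (i + t) (by omega) (by omega) _ rfl⟩
  · rintro ⟨i, h⟩
    refine ⟨i, _, rfl, ?_⟩
    rintro a hia hea _ rfl
    obtain ⟨t, rfl⟩ := Nat.exists_eq_add_of_le hia
    exact h t (by omega)

theorem exists_unbounded_period : UniformlyAutomatic hk fun x _ =>
    ∃ p, 1 ≤ p ∧ ∀ N, ∃ i, ∀ t < N, x (i + t) = x (i + t + p) := by
  -- The condition 1 ≤ p is coded as p + p ≠ p.
  refine ((add (hk := hk) 0 0 0).not.and (exists_period hk).all).ex.congr fun x v => ?_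
  simp only [consVal]
  exact exists_congr fun p => and_congr (by omega) Iff.rfl

theorem hasArbitrarilyLongUnbordered :
    UniformlyAutomatic hk fun x _ => HasArbitrarilyLongUnbordered x := by
  -- The variables from outside in: N, n, i, e = i + n, s, d = s + s, a, b = a + s.
  have h1 := ((add (hk := hk) 1 3 0).imp ((le 4 0).not.imp (sequence_eq 1 0))).all
  have h2 := ((le 4 0).imp h1).all
  have h3 := ((add 1 1 0).and ((le 4 0).and ((le 4 1).not.and h2))).ex.ex
  refine ((le 1 0).and ((add 1 2 0).and h3.not).ex.ex).ex.all.congr fun x v => ?_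
  simp only [consVal, HasArbitrarilyLongUnbordered, isBordered_factor_iff]
  have key : ∀ n i, (∃ e, i + n = e ∧ ¬ ∃ s d, s + s = d ∧ n ≤ d ∧ ¬ n ≤ s ∧
      ∀ a, i ≤ a → ∀ b, a + s = b → ¬ e ≤ b → x a = x b) ↔
      ¬ ∃ s, n ≤ s + s ∧ s < n ∧ ∀ t < n - s, x (i + t) = x (i + t + s) := by
    intro n i
    rw [exists_eq_left']
    refine not_congr (exists_congr fun s => ?_)
    rw [exists_eq_left', not_le]
    refine and_congr_right fun _ => and_congr_right fun _ => ⟨fun h t ht => ?_, ?_⟩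
    · exact h (i + t) (by omega) _ rfl (by omega)
    · rintro h a hia _ rfl hb
      obtain ⟨t, rfl⟩ := Nat.exists_eq_add_of_le hia
      exact h t (by omega)
  simp only [key]
  refine forall_congr' fun N => ⟨?_, ?_⟩
  · rintro ⟨n, hn, i, h⟩
    exact ⟨i, n, hn, h⟩
  · rintro ⟨i, n, hn, h⟩
    exact ⟨n, hn, i, h⟩

end UniformlyAutomatic

/-- An automatic sequence with powers of arbitrarily large exponent has such powers with one and
the same period. -/
theorem DFAO.hasArbitrarilyLargePowers_iff {k : ℕ} (hk : 2 ≤ k) (M : DFAO k) :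
    HasArbitrarilyLargePowers (M.sequence hk) ↔ ∃ p, 1 ≤ p ∧ ∀ N, ∃ i, ∀ t < N,
      M.sequence hk (i + t) = M.sequence hk (i + t + p) := by
  constructor
  · intro h
    obtain ⟨N, -, D, -, hM⟩ := UniformlyAutomatic.exists_period hk
    have hidx := (hM M).1
    generalize N M.code = N at hidx
    -- This exponent gives n - p ≥ k^(N+1) p, so n - p exceeds the digit length of p by enough to be
    -- pumped with p as the only nonzero parameter.
    obtain ⟨i, n, e, hCe, he⟩ := h ((k ^ (N + 1) + 1 : ℕ) : ℚ)
    obtain ⟨p, hp, hpn, rfl, hper⟩ := he.exists_period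
    rw [le_div_iff₀ (by positivity)] at hCe
    have hn : (k ^ (N + 1) + 1) * p ≤ n := by exact_mod_cast hCe
    have hv : ∀ i, consVal p (fun _ => 0) i < k ^ (Nat.log k p + 1) := by
      rintro (_ | i)
      · exact Nat.lt_pow_succ_log_self (by omega) p
      · exact Nat.pow_pos (by omega)
    have hy : k ^ (Nat.log k p + 1 + N) ≤ n - p := by
      have h1 := Nat.mul_le_mul_left (k ^ (N + 1))
        (Nat.pow_log_le_self k (show p ≠ 0 by omega))
      rw [← pow_add, show N + 1 + Nat.log k p = Nat.log k p + 1 + N by ring] at h1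
      rw [add_mul, one_mul] at hn
      omega
    refine ⟨p, hp, fun B => ?_⟩
    obtain ⟨z, hz, j, hj⟩ := hidx.exists_ge_of_large hk hv hy ⟨i, hper⟩ B
    exact ⟨j, fun t ht => hj t (ht.trans_le hz)⟩
  · rintro ⟨p, hp, h⟩ C
    obtain ⟨m, hm⟩ := exists_nat_ge C
    obtain ⟨i, hi⟩ := h (p * (m + 1))
    refine ⟨i, p * (m + 1), (m + 1 : ℕ), hm.trans (by exact_mod_cast m.le_succ), ?_⟩
    exact isFractionalPower_of_period hp (by omega) hi

theorem mainTheorem5 (k : ℕ) (hk : 2 ≤ k) :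
    (∀ M : DFAO k, criticalExponent (M.sequence hk) = ⊤ ↔
      HasArbitrarilyLargePowers (M.sequence hk)) ∧
    DFAO.IsDecidable (fun M : DFAO k => HasArbitrarilyLargePowers (M.sequence hk)) ∧
    DFAO.IsDecidable (fun M : DFAO k => HasArbitrarilyLongUnbordered (M.sequence hk)) := by
  refine ⟨fun M => criticalExponent_eq_top_iff, ?_,
    (UniformlyAutomatic.hasArbitrarilyLongUnbordered hk).isDecidable⟩
  simp only [DFAO.hasArbitrarilyLargePowers_iff]
  exact (UniformlyAutomatic.exists_unbounded_period hk).isDecidable
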